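/- Let $\mathsf X$ be a separable real Hilbert space, let $(\Omega,\mathcal B)$ be a standard Borel space with a nonatomic probability measure $\mathbb P$, let $\mathcal X:=L^2(\Omega,\mathcal B,\mathbb P;\mathsf X)$, and let $\lambda\in\mathbb R$. **Notation.** $\mathcal P_2(\mathsf X)$ and $\mathcal P_2(\mathsf X\times\mathsf X)$ are the Borel probability measures with finite second moment, and $\Gamma(\mu,\nu)$ is the set of all couplings of $\mu$ and $\nu$. - An operator $B\subset\mathcal X\times\mathcal X$, with domain $D(B)=\{X:\exists V,\ (X,V)\in B\}$, is *$\lambda$-dissipative* if $\langle V-W,X-Y\rangle\le\lambda|X-Y|^2$ for all $(X,V),(Y,W)\in B$, and *maximal $\lambda$-dissipative* if it is maximal for inclusion among $\lambda$-dissipative operators. It is *invariant by measure-preserving isomorphisms* if $(X,V)\in B$ implies $(X\circ g,V\circ g)\in B$ for every measurable $g:\Omega\to\Omega$ with $g_\sharp\mathbb P=\mathbb P$ that is injective on a measurable set of full measure. It is *law invariant* if $(X,V)\in B$ and $(X',V')_\sharp\mathbb P=(X,V)_\sharp\mathbb P$ imply $(X',V')\in B$. - A *multivalued probability vector field* (MPVF)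 is a nonempty set $F\subset\mathcal P_2(\mathsf X\times\mathsf X)$. Its domain $D(F)\subset\mathcal P_2(\mathsf X)$ is the set of first marginals of its elements. A set $F\subset\mathcal P_2(\mathsf X\times\mathsf X)$ is *totally $\lambda$-dissipative* if for all $\Phi_0,\Phi_1\in F$ and all $\vartheta\in\Gamma(\Phi_0,\Phi_1)$ $$\int\langle v_1-v_0,x_1-x_0\rangle\,d\vartheta(x_0,v_0,x_1,v_1)\le\lambda\int|x_1-x_0|^2\,d\vartheta ,$$ and an MPVF is *maximal totally $\lambda$-dissipative* if it is maximal for inclusion among totally $\lambda$-dissipative MPVFs. - The *Lagrangian representation* of $F$ is $B_F:=\{(X,V)\in\mathcal X\times\mathcal X:(X,V)_\sharp\mathbb P\in F\}$. - A set $K\subset\mathcal P_2(\mathsf X)$ is *totally convex* if $((1-t)x_0+t x_1)_\sharp\gamma\in K$ for all $\mu_0,\mu_1\in K$, $\gamma\in\Gamma(\mu_0,\mu_1)$ and $t\in[0,1]$. **Theorem.** 0. For every $F\subset\mathcal P_2(\mathsf X\times\mathsf X)$, the Lagrangian representation $B_F$ is law invariant, and $F$ is totally $\lambda$-dissipative if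 and only if $B_F$ is $\lambda$-dissipative. 1. Every $\lambda$-dissipative operator $B\subset\mathcal X\times\mathcal X$ that is invariant by measure-preserving isomorphisms has a maximal $\lambda$-dissipative extension $\hat B\supset B$ that is invariant by measure-preserving isomorphisms and law invariant and, if $B\neq\emptyset$, satisfies $D(\hat B)\subset\overline{\mathrm{conv}}\,D(B)$. 2. For every MPVF $F$, the operator $B_F$ is maximal $\lambda$-dissipative if and only if $F$ is maximal totally $\lambda$-dissipative. 3. If $F$ is a totally $\lambda$-dissipative MPVF with $D(F)\subset K$, where $K\subset\mathcal P_2(\mathsf X)$ is totally convex and closed for the Wasserstein distance $W_2$, then $F$ has a maximal totally $\lambda$-dissipative extension $\hat F\supset F$ with $D(\hat F)\subset K$. In particular (with $K=\mathcal P_2(\mathsf X)$) every totally $\lambda$-dissipative MPVF has a maximal totally $\lambda$-dissipative extension. -/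

import Mathlib

open MeasureTheory Filter Topology

open scoped ENNReal

noncomputable section

/-! ### Multivalued operators in a Hilbert space -/

section Operators

variable {E : Type*} [NormedAddCommGroup E] [InnerProductSpace ℝ E]

/-- The domain of a multivalued operator, identified with its graph `B`. -/
def opDomain (B : Set (E × E)) : Set E := {x | ∃ v, (x, v) ∈ B}

/-- `B` is `lam`-dissipative: `⟪v - w, x - y⟫ ≤ lam |x - y|²` for all `(x, v), (y, w) ∈ B`. -/
def IsDissipative (lam : ℝ) (B : Set (E × E)) : Prop :=
  ∀ p ∈ B, ∀ q ∈ B, inner ℝ (p.2 - q.2) (p.1 - q.1) ≤ lam * ‖p.1 - q.1‖ ^ 2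

/-- `B` is maximal, with respect to inclusion, in the class of `lam`-dissipative operators. -/
def IsMaximalDissipative (lam : ℝ) (B : Set (E × E)) : Prop :=
  Maximal (IsDissipative lam) B

end Operators

/-! ### Measures with finite second moment, couplings, Wasserstein distance -/

/-- The Borel probability measures with finite second moment. On a product `H × H` the norm is
the maximum of the two norms, which is equivalent to `(|x|² + |v|²)^(1/2)`, so that the condition
is the usual one. -/
def probTwo (E : Type*) [NormedAddCommGroup E] [MeasurableSpace E] : Set (Measure E) :=
  {μ | IsProbabilityMeasure μ ∧ ∫⁻ x, ‖x‖ₑ ^ 2 ∂μ < ∞}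

/-- The set `Γ(μ, ν)` of couplings of `μ` and `ν`. -/
def couplings {S T : Type*} [MeasurableSpace S] [MeasurableSpace T]
    (μ : Measure S) (ν : Measure T) : Set (Measure (S × T)) :=
  {γ | IsProbabilityMeasure γ ∧ γ.map Prod.fst = μ ∧ γ.map Prod.snd = ν}

section Wasserstein

variable {H : Type*} [NormedAddCommGroup H] [InnerProductSpace ℝ H] [MeasurableSpace H]

/-- The `L²`-Wasserstein distance. -/
def wassersteinTwo (μ ν : Measure H) : ℝ≥0∞ :=
  (⨅ γ ∈ couplings μ ν, ∫⁻ z, ‖z.1 - z.2‖ₑ ^ 2 ∂γ) ^ (1 / 2 : ℝ)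

/-- `K` is closed in `(P₂(H), W₂)`. Sequences suffice, since `W₂` is a metric on `P₂(H)`. -/
def IsWassersteinClosed (K : Set (Measure H)) : Prop :=
  ∀ (μs : ℕ → Measure H) (μ : Measure H), (∀ n, μs n ∈ K) → μ ∈ probTwo H →
    Tendsto (fun n => wassersteinTwo (μs n) μ) atTop (𝓝 0) → μ ∈ K

/-- `K` is totally convex: it is stable under interpolation along all couplings (and not only
the optimal ones) of its elements. -/
def IsTotallyConvex (K : Set (Measure H)) : Prop :=
  ∀ μ₀ ∈ K, ∀ μ₁ ∈ K, ∀ γ ∈ couplings μ₀ μ₁, ∀ t ∈ Set.Icc (0 : ℝ) 1,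
    γ.map (fun z : H × H => (1 - t) • z.1 + t • z.2) ∈ K

/-! ### Multivalued probability vector fields -/

/-- A multivalued probability vector field: a nonempty subset of `P₂(TH)`, where `TH = H × H`. -/
def IsMPVF (F : Set (Measure (H × H))) : Prop :=
  F.Nonempty ∧ F ⊆ probTwo (H × H)

/-- The domain of `F`: the set of the first marginals of its elements. -/
def mpvfDomain (F : Set (Measure (H × H))) : Set (Measure H) :=
  {μ | ∃ Φ ∈ F, Φ.map Prod.fst = μ}

/-- Total `lam`-dissipativity. The points of `(H × H) × (H × H)` are `((x₀, v₀), (x₁, v₁))`. -/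
def IsTotallyDissipative (lam : ℝ) (F : Set (Measure (H × H))) : Prop :=
  ∀ Φ₀ ∈ F, ∀ Φ₁ ∈ F, ∀ θ ∈ couplings Φ₀ Φ₁,
    ∫ z, inner ℝ (z.2.2 - z.1.2) (z.2.1 - z.1.1) ∂θ ≤ lam * ∫ z, ‖z.2.1 - z.1.1‖ ^ 2 ∂θ

/-- `F` is maximal, with respect to inclusion, in the class of totally `lam`-dissipative
multivalued probability vector fields. -/
def IsMaximalTotallyDissipative (lam : ℝ) (F : Set (Measure (H × H))) : Prop :=
  Maximal (fun G => IsMPVF G ∧ IsTotallyDissipative lam G) F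

end Wasserstein

/-! ### Random variables, invariant operators, Lagrangian representations -/

section Lagrangian

variable {Ω : Type*} [MeasurableSpace Ω]
variable {H : Type*} [NormedAddCommGroup H] [MeasurableSpace H]

/-- Measure-preserving isomorphisms: measurable, measure-preserving, essentially injective. -/
structure IsMeasurePreservingIso (P : Measure Ω) (g : Ω → Ω) : Prop where
  measurePreserving : MeasurePreserving g P P
  essInjective : ∃ Ω₀ : Set Ω, MeasurableSet Ω₀ ∧ P Ω₀ᶜ = 0 ∧ Set.InjOn g Ω₀

/-- The joint law `(X, V)_♯ P` of two square-integrable random variables. -/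
def jointLaw {P : Measure Ω} (p : Lp H 2 P × Lp H 2 P) : Measure (H × H) :=
  P.map (fun ω => (p.1 ω, p.2 ω))

/-- `B` is invariant by measure-preserving isomorphisms: `(X, V) ∈ B` implies
`(X ∘ g, V ∘ g) ∈ B`. -/
def IsIsoInvariant {P : Measure Ω} (B : Set (Lp H 2 P × Lp H 2 P)) : Prop :=
  ∀ (g : Ω → Ω) (hg : IsMeasurePreservingIso P g), ∀ p ∈ B,
    (Lp.compMeasurePreserving g hg.measurePreserving p.1,
      Lp.compMeasurePreserving g hg.measurePreserving p.2) ∈ B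

/-- `B` is law invariant: membership in `B` only depends on the joint law. -/
def IsLawInvariant {P : Measure Ω} (B : Set (Lp H 2 P × Lp H 2 P)) : Prop :=
  ∀ p ∈ B, ∀ q : Lp H 2 P × Lp H 2 P, jointLaw p = jointLaw q → q ∈ B

/-- The Lagrangian representation of `F`: all pairs whose joint law belongs to `F`. -/
def lagrangianRep (P : Measure Ω) (F : Set (Measure (H × H))) : Set (Lp H 2 P × Lp H 2 P) :=
  {p | jointLaw p ∈ F}

end Lagrangian

end

/-!
Up to the change of variables `(x, v) ↦ (x, lam x - v)` the operators are monotone. The heart of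
the proof is a maximal extension of a monotone operator `A` in a Hilbert space that is given by a
formula, hence inherits all the isometric symmetries of `A` without any choice. Let
`f(x, v) = sup {⟪x, b⟫ + ⟪a, v⟫ - ⟪a, b⟫ : (a, b) ∈ A}` be the Fitzpatrick function, restricted to
`C × E`, where `C` is the closed convex hull of `D(A)`, and let `(x, v)` be the proximal point of
`(y, y)` for `f`. Firm nonexpansiveness of proximal maps gives
`|(x - v) - (x' - v')| ≤ |y - y'|`, so `y ↦ x - v` is the Cayley transform of a maximal monotone
operator. It extends `A`, because `(w, u)` is a subgradient of `f` at every `(u, w) ∈ A`. Its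
resolvent is `y ↦ (x + (y - v)) / 2`, which lies in `C`: `x` does by definition, and `y - v` does
because it is a subgradient in `v` of a supremum of affine functions with slopes in `D(A)`
(`IsFitzpatrickProx`, `exists_isMaximalDissipative_extension`).

In `L²` the symmetries are the maps `X ↦ X ∘ g`. Two random variables with the same law can be
brought uniformly close to each other by a measure-preserving isomorphism
(`exists_isMeasurePreservingIso_dist_lt`): after discretisation one may suppose them integer valued,
and the isomorphism comes from the distribution function of a real random variable with that
integer part which generates the σ-algebra. A closed invariant operator is therefore law invariant
(`IsIsoInvariant.isLawInvariant`), and maximal operators are closed.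

Since every coupling is the joint law of random variables on `Ω`, law-invariant operators and sets
of laws correspond to each other, dissipativity of the former being total dissipativity of the
latter (`isTotallyDissipative_iff`). The domain in a totally convex closed `K` is controlled because
the random variables with law in `K` form a closed convex set.
-/

noncomputable section

/-! ### A variational problem on closed convex sets -/

section Variational

variable {Z : Type*} [NormedAddCommGroup Z] [InnerProductSpace ℝ Z] [CompleteSpace Z]

/-- The proximal point of `q` for a convex lower semicontinuous function, described through its
closed convex epigraph `K`: it minimises `t + |z - q|² / 2` over `K`, and the conclusion is the
Euler inequality of this minimum. -/
theorem exists_prox_of_isClosed_convex {K : Set (Z × ℝ)} (hne : K.Nonempty) (hcl : IsClosed K)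
    (hconv : Convex ℝ K) (q : Z) {m : ℝ} (hm : ∀ p ∈ K, m ≤ p.2 + ‖p.1 - q‖ ^ 2 / 2) :
    ∃ p ∈ K, ∀ p' ∈ K, inner ℝ (q - p.1) (p'.1 - p.1) ≤ p'.2 - p.2 := by
  set Q : Z × ℝ → ℝ := fun p => p.2 + ‖p.1 - q‖ ^ 2 / 2 with hQ
  set S : Set ℝ := Q '' K with hS
  have hSne : S.Nonempty := hne.image Q
  have hSb : BddBelow S := ⟨m, by rintro _ ⟨p, hp, rfl⟩; exact hm p hp⟩
  set i : ℝ := sInf S with hi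
  have hle : ∀ p ∈ K, i ≤ Q p := fun p hp => csInf_le hSb ⟨p, hp, rfl⟩
  have hex : ∀ n : ℕ, ∃ p ∈ K, Q p < i + 1 / ((n : ℝ) + 1) := by
    intro n
    obtain ⟨_, ⟨p, hp, rfl⟩, h⟩ :=
      exists_lt_of_csInf_lt hSne (lt_add_of_pos_right i (Nat.one_div_pos_of_nat (α := ℝ) (n := n)))
    exact ⟨p, hp, h⟩
  choose p hpK hpQ using hex
  -- Convexity of `K` and the parallelogram identity make a minimising sequence Cauchy.
  have hpar : ∀ a ∈ K, ∀ b ∈ K, ‖a.1 - b.1‖ ^ 2 ≤ 4 * (Q a + Q b - 2 * i) := by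
    intro a ha b hb
    have hmid := hle _ (hconv ha hb (a := 1 / 2) (b := 1 / 2) (by norm_num) (by norm_num)
      (by norm_num))
    have e1 : ((1 / 2 : ℝ) • a + (1 / 2 : ℝ) • b).1 - q
        = (1 / 2 : ℝ) • ((a.1 - q) + (b.1 - q)) := by
      simp only [Prod.fst_add, Prod.smul_fst]; module
    have e2 : ((1 / 2 : ℝ) • a + (1 / 2 : ℝ) • b).2 = (a.2 + b.2) / 2 := by
      simp only [Prod.snd_add, Prod.smul_snd, smul_eq_mul]; ring
    have h3 := parallelogram_law_with_norm ℝ (a.1 - q) (b.1 - q)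
    have e4 : (a.1 - q) - (b.1 - q) = a.1 - b.1 := by abel
    simp only [hQ, e1, e2, norm_smul] at hmid ⊢
    rw [e4] at h3
    norm_num at hmid
    nlinarith
  have hcau : CauchySeq (fun n => (p n).1) := by
    refine cauchySeq_of_le_tendsto_0 (fun n : ℕ => √(8 * (1 / ((n : ℝ) + 1)))) ?_ ?_
    · intro n k N hn hk
      rw [dist_eq_norm]
      refine Real.le_sqrt_of_sq_le ?_
      have := hpar _ (hpK n) _ (hpK k)
      have h1 : 1 / ((n : ℝ) + 1) ≤ 1 / ((N : ℝ) + 1) := Nat.one_div_le_one_div hn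
      have h2 : 1 / ((k : ℝ) + 1) ≤ 1 / ((N : ℝ) + 1) := Nat.one_div_le_one_div hk
      linarith [hpQ n, hpQ k]
    · have h := (tendsto_one_div_add_atTop_nhds_zero_nat (𝕜 := ℝ)).const_mul 8
      have h2 := (Real.continuous_sqrt.tendsto _).comp h
      rw [mul_zero, Real.sqrt_zero] at h2
      exact h2
  obtain ⟨z, hz⟩ := cauchySeq_tendsto_of_complete hcau
  have hQlim : Tendsto (fun n => Q (p n)) atTop (𝓝 i) := by
    have h := (tendsto_one_div_add_atTop_nhds_zero_nat (𝕜 := ℝ)).const_add i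
    rw [add_zero] at h
    exact tendsto_of_tendsto_of_tendsto_of_le_of_le tendsto_const_nhds h
      (fun n => hle _ (hpK n)) (fun n => (hpQ n).le)
  have hnlim : Tendsto (fun n => ‖(p n).1 - q‖ ^ 2 / 2) atTop (𝓝 (‖z - q‖ ^ 2 / 2)) :=
    (((hz.sub_const q).norm).pow 2).div_const 2
  have htlim : Tendsto (fun n => (p n).2) atTop (𝓝 (i - ‖z - q‖ ^ 2 / 2)) := by
    refine (hQlim.sub hnlim).congr fun n => ?_
    simp [hQ]
  set p₀ : Z × ℝ := (z, i - ‖z - q‖ ^ 2 / 2) with hp₀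
  have hp₀K : p₀ ∈ K :=
    hcl.mem_of_tendsto (hz.prodMk_nhds htlim) (Eventually.of_forall hpK)
  refine ⟨p₀, hp₀K, fun p' hp' => ?_⟩
  have hmin : Q p₀ = i := by simp [hQ, hp₀]
  -- The Euler inequality is the first-order term of minimality along the segment to `p'`.
  have hseg : ∀ s : ℝ, 0 < s → s ≤ 1 →
      inner ℝ (q - p₀.1) (p'.1 - p₀.1) - (p'.2 - p₀.2) ≤ s * (‖p'.1 - p₀.1‖ ^ 2 / 2) := by
    intro s hs hs1
    have h := hle _ (hconv hp₀K hp' (a := 1 - s) (b := s) (by linarith) hs.le (by ring))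
    rw [← hmin] at h
    have e1 : ((1 - s) • p₀ + s • p').1 - q = s • (p'.1 - p₀.1) - (q - p₀.1) := by
      simp only [Prod.fst_add, Prod.smul_fst]; module
    have e2 : ((1 - s) • p₀ + s • p').2 = (1 - s) * p₀.2 + s * p'.2 := by
      simp
    simp only [hQ, e1, e2] at h
    rw [norm_sub_sq_real (s • _), norm_smul, inner_smul_left, norm_sub_rev p₀.1 q,
      real_inner_comm, Real.norm_of_nonneg hs.le] at h
    simp only [conj_trivial] at h
    have : s * (inner ℝ (q - p₀.1) (p'.1 - p₀.1) - (p'.2 - p₀.2))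
        ≤ s * (s * (‖p'.1 - p₀.1‖ ^ 2 / 2)) := by nlinarith
    exact le_of_mul_le_mul_left this hs
  have hlim : Tendsto (fun s : ℝ => s * (‖p'.1 - p₀.1‖ ^ 2 / 2)) (𝓝[>] 0) (𝓝 0) := by
    have : Tendsto (fun s : ℝ => s * (‖p'.1 - p₀.1‖ ^ 2 / 2)) (𝓝 0)
        (𝓝 (0 * (‖p'.1 - p₀.1‖ ^ 2 / 2))) := tendsto_id.mul_const _
    rw [zero_mul] at this
    exact this.mono_left nhdsWithin_le_nhds
  have := ge_of_tendsto hlim (b := inner ℝ (q - p₀.1) (p'.1 - p₀.1) - (p'.2 - p₀.2)) (by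
    filter_upwards [Ioc_mem_nhdsGT (zero_lt_one (α := ℝ))] with s hs
    exact hseg s hs.1 hs.2)
  linarith

end Variational

/-! ### An explicit maximal extension of a monotone operator -/

section Extension

variable {E : Type*} [NormedAddCommGroup E] [InnerProductSpace ℝ E]

/-- Monotone multivalued operators, identified with their graphs. -/
def IsMonotoneOp (A : Set (E × E)) : Prop :=
  ∀ p ∈ A, ∀ r ∈ A, 0 ≤ inner ℝ (p.2 - r.2) (p.1 - r.1)

/-- `IsFitzpatrickProx A C y x v t` says that `(x, v)` is the proximal point of `(y, y)` for the
Fitzpatrick function `f(x, v) = sup {⟪x, b⟫ + ⟪a, v⟫ - ⟪a, b⟫ : (a, b) ∈ A}` of `A` restricted to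
`C × E`, and that `t = f(x, v)`; the last clause is the inclusion of `(y - x, y - v)` in the
subdifferential, written in terms of the epigraph so as to avoid the value `+∞`. -/
structure IsFitzpatrickProx (A : Set (E × E)) (C : Set E) (y x v : E) (t : ℝ) : Prop where
  mem : x ∈ C
  le : ∀ p ∈ A, inner ℝ x p.2 + inner ℝ p.1 v - inner ℝ p.1 p.2 ≤ t
  euler : ∀ x' ∈ C, ∀ (v' : E) (t' : ℝ),
    (∀ p ∈ A, inner ℝ x' p.2 + inner ℝ p.1 v' - inner ℝ p.1 p.2 ≤ t') →
      inner ℝ (y - x) (x' - x) + inner ℝ (y - v) (v' - v) ≤ t' - t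

variable {A : Set (E × E)} {C : Set E}

theorem exists_isFitzpatrickProx [CompleteSpace E] (hA : A.Nonempty)
    (hmono : IsMonotoneOp A)
    (hcl : IsClosed C) (hconv : Convex ℝ C) (hAC : opDomain A ⊆ C) (y : E) :
    ∃ x v t, IsFitzpatrickProx A C y x v t := by
  set K : Set (WithLp 2 (E × E) × ℝ) := {k | k.1.fst ∈ C ∧
    ∀ p ∈ A, inner ℝ k.1.fst p.2 + inner ℝ p.1 k.1.snd - inner ℝ p.1 p.2 ≤ k.2} with hK
  obtain ⟨⟨a, b⟩, hab⟩ := hA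
  have hKne : K.Nonempty := by
    refine ⟨(WithLp.toLp 2 (a, b), inner ℝ a b), hAC ⟨b, hab⟩, fun p hp => ?_⟩
    have := hmono _ hab _ hp
    simp only [inner_sub_left, inner_sub_right] at this
    rw [real_inner_comm a b, real_inner_comm p.1 b, real_inner_comm a p.2,
      real_inner_comm p.1 p.2] at this
    change inner ℝ a p.2 + inner ℝ p.1 b - inner ℝ p.1 p.2 ≤ inner ℝ a b
    linarith
  have hKcl : IsClosed K := by
    have h1 : Continuous fun k : WithLp 2 (E × E) × ℝ => k.1.fst := by fun_prop
    have h2 : Continuous fun k : WithLp 2 (E × E) × ℝ => k.1.snd := by fun_prop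
    have e : K = (fun k : WithLp 2 (E × E) × ℝ => k.1.fst) ⁻¹' C ∩ ⋂ p ∈ A,
        {k | inner ℝ k.1.fst p.2 + inner ℝ p.1 k.1.snd - inner ℝ p.1 p.2 ≤ k.2} := by
      ext k
      simp [hK]
    rw [e]
    exact (hcl.preimage h1).inter (isClosed_biInter fun p _ =>
      isClosed_le (by fun_prop) (by fun_prop))
  have hKconv : Convex ℝ K := by
    rintro k ⟨hk, hk'⟩ l ⟨hl, hl'⟩ c d hc hd hcd
    refine ⟨hconv hk hl hc hd hcd, fun p hp => ?_⟩
    have e : inner ℝ (c • k + d • l).1.fst p.2 + inner ℝ p.1 (c • k + d • l).1.snd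
        - inner ℝ p.1 p.2
        = c * (inner ℝ k.1.fst p.2 + inner ℝ p.1 k.1.snd - inner ℝ p.1 p.2)
          + d * (inner ℝ l.1.fst p.2 + inner ℝ p.1 l.1.snd - inner ℝ p.1 p.2) := by
      simp only [Prod.fst_add, Prod.smul_fst, WithLp.add_fst, WithLp.smul_fst, WithLp.add_snd,
        WithLp.smul_snd, inner_add_left, inner_add_right, inner_smul_left, inner_smul_right,
        conj_trivial]
      linear_combination (inner ℝ p.1 p.2) * hcd
    rw [e]
    simp only [Prod.snd_add, Prod.smul_snd, smul_eq_mul]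
    exact add_le_add (mul_le_mul_of_nonneg_left (hk' p hp) hc)
      (mul_le_mul_of_nonneg_left (hl' p hp) hd)
  -- One affine minorant of the Fitzpatrick function suffices to bound the functional from below.
  have hbd : ∀ k ∈ K, inner ℝ y b + inner ℝ a y - ‖a‖ ^ 2 / 2 - ‖b‖ ^ 2 / 2 - inner ℝ a b
      ≤ k.2 + ‖k.1 - WithLp.toLp 2 (y, y)‖ ^ 2 / 2 := by
    rintro k ⟨-, hk⟩
    have h := hk _ hab
    rw [WithLp.prod_norm_sq_eq_of_L2]
    simp only [WithLp.sub_fst, WithLp.sub_snd] at *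
    have h1 := norm_add_sq_real (k.1.fst - y) b
    have h2 := norm_add_sq_real (k.1.snd - y) a
    simp only [inner_sub_left] at h1 h2
    rw [real_inner_comm a y, real_inner_comm a k.1.snd] at h2
    change _ ≤ k.2 + (‖k.1.fst - y‖ ^ 2 + ‖k.1.snd - y‖ ^ 2) / 2
    linarith [sq_nonneg ‖k.1.fst - y + b‖, sq_nonneg ‖k.1.snd - y + a‖]
  obtain ⟨k, ⟨hkC, hkA⟩, hk⟩ := exists_prox_of_isClosed_convex hKne hKcl hKconv
    (WithLp.toLp 2 (y, y)) hbd
  refine ⟨k.1.fst, k.1.snd, k.2, hkC, hkA, fun x' hx' v' t' h' => ?_⟩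
  have := hk (WithLp.toLp 2 (x', v'), t') ⟨hx', h'⟩
  simpa [WithLp.prod_inner_apply] using this

/-- At a point of the graph the proximal point is the point itself: this is why the resolvent
below extends that of `A`. -/
theorem isFitzpatrickProx_of_mem
    (hmono : IsMonotoneOp A) (hAC : opDomain A ⊆ C)
    {u w : E} (h : (u, w) ∈ A) : IsFitzpatrickProx A C (u + w) u w (inner ℝ u w) := by
  refine ⟨hAC ⟨w, h⟩, fun p hp => ?_, fun x' _ v' t' h' => ?_⟩
  · have := hmono _ h _ hp
    simp only [inner_sub_left, inner_sub_right] at this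
    rw [real_inner_comm u w, real_inner_comm p.1 w, real_inner_comm u p.2,
      real_inner_comm p.1 p.2] at this
    linarith
  · have := h' _ h
    simp only [add_sub_cancel_left, add_sub_cancel_right, inner_sub_right]
    simp only [real_inner_comm w] at *
    linarith

/-- Proximal maps are firmly nonexpansive. -/
theorem IsFitzpatrickProx.firm {y x v y' x' v' : E} {t t' : ℝ} (h : IsFitzpatrickProx A C y x v t)
    (h' : IsFitzpatrickProx A C y' x' v' t') :
    ‖x - x'‖ ^ 2 + ‖v - v'‖ ^ 2 ≤ inner ℝ ((x - x') + (v - v')) (y - y') := by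
  have h1 := h.euler x' h'.mem v' t' h'.le
  have h2 := h'.euler x h.mem v t h.le
  have e (c c' y y' : E) : inner ℝ (c - c') (y - y') - ‖c - c'‖ ^ 2
      = -(inner ℝ (y - c) (c' - c) + inner ℝ (y' - c') (c - c')) := by
    rw [← neg_sub c c', inner_neg_right, ← real_inner_self_eq_norm_sq, neg_add, neg_neg,
      ← sub_eq_add_neg, ← inner_sub_left, real_inner_comm, ← inner_sub_left]
    congr 1
    abel
  have e1 := e x x' y y'
  have e2 := e v v' y y'
  rw [inner_add_left]
  linarith

theorem IsFitzpatrickProx.norm_sub_le {y x v y' x' v' : E} {t t' : ℝ}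
    (h : IsFitzpatrickProx A C y x v t) (h' : IsFitzpatrickProx A C y' x' v' t') :
    ‖(x - v) - (x' - v')‖ ≤ ‖y - y'‖ := by
  have h1 := h.firm h'
  have h2 := parallelogram_law_with_norm ℝ (x - x') (v - v')
  have h3 := norm_sub_sq_real ((x - x') + (v - v')) (y - y')
  have e : (x - v) - (x' - v') = (x - x') - (v - v') := by abel
  rw [e]
  refine le_of_sq_le_sq ?_ (norm_nonneg _)
  nlinarith [sq_nonneg ‖(x - x') + (v - v') - (y - y')‖]

/-- The Fitzpatrick function grows in its second variable at most like the support function of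
`D(A)`, hence its subgradients in that variable lie in the closed convex hull of `D(A)`. -/
theorem IsFitzpatrickProx.sub_mem (hcl : IsClosed C) (hconv : Convex ℝ C) [CompleteSpace E]
    (hAC : opDomain A ⊆ C) {y x v : E} {t : ℝ} (h : IsFitzpatrickProx A C y x v t) :
    y - v ∈ C := by
  by_contra hn
  obtain ⟨l, u, hl, hu⟩ := geometric_hahn_banach_closed_point hconv hcl hn
  set d := (InnerProductSpace.toDual ℝ E).symm l with hd
  have hin : ∀ a, inner ℝ a d = l a := fun a => by
    rw [real_inner_comm, hd, InnerProductSpace.toDual_symm_apply]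
  have := h.euler x h.mem (v + d) (t + u) (fun p hp => by
    have h1 := h.le p hp
    have h2 := hl p.1 (hAC ⟨p.2, hp⟩)
    rw [inner_add_right, hin]
    linarith)
  rw [sub_self, inner_zero_right, add_sub_cancel_left, hin] at this
  linarith

theorem IsFitzpatrickProx.map {y x v : E} {t : ℝ} (h : IsFitzpatrickProx A C y x v t)
    (g : E ≃ₗᵢ[ℝ] E) (hA : ∀ p, p ∈ A ↔ (g p.1, g p.2) ∈ A) (hC : ∀ x, x ∈ C ↔ g x ∈ C) :
    IsFitzpatrickProx A C (g y) (g x) (g v) t := by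
  have key : ∀ (x' v' : E) (p : E × E),
      inner ℝ (g x') p.2 + inner ℝ p.1 (g v') - inner ℝ p.1 p.2
        = inner ℝ x' (g.symm p.2) + inner ℝ (g.symm p.1) v'
          - inner ℝ (g.symm p.1) (g.symm p.2) := by
    intro x' v' p
    rw [← g.inner_map_map x', ← g.inner_map_map _ v', ← g.inner_map_map (g.symm p.1) (g.symm p.2)]
    simp
  refine ⟨(hC x).1 h.mem, fun p hp => ?_, fun x' hx' v' t' h' => ?_⟩
  · rw [key]
    exact h.le (g.symm p.1, g.symm p.2) ((hA _).2 (by simpa using hp))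
  · have := h.euler (g.symm x') ((hC _).2 (by simpa using hx')) (g.symm v') t' (fun p hp => by
      have := h' _ ((hA p).1 hp)
      rw [← g.inner_map_map, ← g.inner_map_map p.1, ← g.inner_map_map p.1]
      simpa using this)
    rw [← g.inner_map_map, ← g.inner_map_map (y - v)] at this
    simpa using this

/-- The maximal extension of `A` whose Cayley transform maps `y` to `x - v`, where `(x, v)` is the
proximal point of `(y, y)`; see `IsFitzpatrickProx`. -/
def fitzpatrickExtension (A : Set (E × E)) (C : Set E) : Set (E × E) :=
  {p | ∃ x v t, IsFitzpatrickProx A C (p.1 + p.2) x v t ∧ p.1 - p.2 = x - v}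

theorem subset_fitzpatrickExtension (hmono : IsMonotoneOp A) (hAC : opDomain A ⊆ C) :
    A ⊆ fitzpatrickExtension A C :=
  fun p hp => ⟨p.1, p.2, _, isFitzpatrickProx_of_mem hmono hAC hp, rfl⟩

theorem isMonotoneOp_fitzpatrickExtension : IsMonotoneOp (fitzpatrickExtension A C) := by
  rintro p ⟨x, v, t, h, hp⟩ r ⟨x', v', t', h', hr⟩
  have h1 := h.norm_sub_le h'
  rw [← hp, ← hr] at h1
  have e1 : p.1 - p.2 - (r.1 - r.2) = (p.1 - r.1) - (p.2 - r.2) := by abel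
  have e2 : p.1 + p.2 - (r.1 + r.2) = (p.1 - r.1) + (p.2 - r.2) := by abel
  rw [e1, e2] at h1
  have h2 := pow_le_pow_left₀ (norm_nonneg _) h1 2
  rw [norm_sub_sq_real, norm_add_sq_real] at h2
  rw [real_inner_comm]
  linarith

/-- Minty's criterion: the graph contains some `(x, y - x)` for every `y`, which leaves no room
for a larger monotone operator. -/
theorem eq_fitzpatrickExtension_of_subset [CompleteSpace E] (hA : A.Nonempty)
    (hmono : IsMonotoneOp A) (hcl : IsClosed C) (hconv : Convex ℝ C) (hAC : opDomain A ⊆ C)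
    {G : Set (E × E)} (hG : IsMonotoneOp G) (hsub : fitzpatrickExtension A C ⊆ G) :
    G ⊆ fitzpatrickExtension A C := by
  intro p hp
  obtain ⟨x, v, t, h⟩ := exists_isFitzpatrickProx hA hmono hcl hconv hAC (p.1 + p.2)
  set r : E × E := ((1 / 2 : ℝ) • (p.1 + p.2 + (x - v)), (1 / 2 : ℝ) • (p.1 + p.2 - (x - v)))
    with hr
  have hadd : r.1 + r.2 = p.1 + p.2 := by simp only [hr]; module
  have hsub' : r.1 - r.2 = x - v := by simp only [hr]; module
  have hrm : r ∈ fitzpatrickExtension A C := ⟨x, v, t, by rwa [hadd], hsub'⟩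
  have h1 := hG p hp r (hsub hrm)
  have e : p.2 - r.2 = -(p.1 - r.1) := by
    rw [← sub_eq_zero]
    calc _ = (p.1 + p.2) - (r.1 + r.2) := by abel
      _ = 0 := by rw [hadd, sub_self]
  rw [e, inner_neg_left, real_inner_self_eq_norm_sq] at h1
  have h2 : p.1 - r.1 = 0 := by
    rw [← norm_eq_zero]
    exact pow_eq_zero_iff two_ne_zero |>.1 (le_antisymm (by linarith) (sq_nonneg _))
  rw [h2, neg_zero] at e
  have : p = r := Prod.ext (sub_eq_zero.1 h2) (sub_eq_zero.1 e)
  rwa [this]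

theorem opDomain_fitzpatrickExtension_subset [CompleteSpace E] (hcl : IsClosed C)
    (hconv : Convex ℝ C) (hAC : opDomain A ⊆ C) : opDomain (fitzpatrickExtension A C) ⊆ C := by
  rintro z ⟨w, x, v, t, h, hz⟩
  have h1 := hconv h.mem (h.sub_mem hcl hconv hAC) (a := 1 / 2) (b := 1 / 2) (by norm_num)
    (by norm_num) (by norm_num)
  convert h1 using 1
  simp only at hz
  have : x = z - w + v := by rw [hz]; abel
  rw [this]
  simp only
  module

theorem map_mem_fitzpatrickExtension (g : E ≃ₗᵢ[ℝ] E) (hA : ∀ p, p ∈ A ↔ (g p.1, g p.2) ∈ A)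
    (hC : ∀ x, x ∈ C ↔ g x ∈ C) {p : E × E} (hp : p ∈ fitzpatrickExtension A C) :
    (g p.1, g p.2) ∈ fitzpatrickExtension A C := by
  obtain ⟨x, v, t, h, hp⟩ := hp
  refine ⟨g x, g v, t, ?_, ?_⟩
  · simpa using h.map g hA hC
  · simp only [← map_sub, hp]

theorem map_mem_closure_convexHull {D : Set E} (g : E ≃ₗᵢ[ℝ] E) (hD : ∀ x ∈ D, g x ∈ D) {x : E}
    (hx : x ∈ closure (convexHull ℝ D)) : g x ∈ closure (convexHull ℝ D) := by
  have h1 : convexHull ℝ D ⊆ g ⁻¹' (convexHull ℝ D) :=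
    convexHull_min (fun z hz => subset_convexHull ℝ D (hD z hz))
      ((convex_convexHull ℝ D).linear_preimage g.toLinearEquiv.toLinearMap)
  exact map_mem_closure g.continuous hx h1

end Extension

/-! ### Dissipative operators -/

section Dissipative

variable {E : Type*} [NormedAddCommGroup E] [InnerProductSpace ℝ E]

/-- The involution `(x, v) ↦ (x, lam x - v)`, exchanging `lam`-dissipative and monotone
operators. -/
def dissipativeFlip (lam : ℝ) (p : E × E) : E × E := (p.1, lam • p.1 - p.2)

theorem dissipativeFlip_dissipativeFlip (lam : ℝ) (p : E × E) :
    dissipativeFlip lam (dissipativeFlip lam p) = p := by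
  simp [dissipativeFlip]

theorem inner_dissipativeFlip (lam : ℝ) (p q : E × E) :
    inner ℝ ((dissipativeFlip lam p).2 - (dissipativeFlip lam q).2)
        ((dissipativeFlip lam p).1 - (dissipativeFlip lam q).1)
      = lam * ‖p.1 - q.1‖ ^ 2 - inner ℝ (p.2 - q.2) (p.1 - q.1) := by
  have : (dissipativeFlip lam p).2 - (dissipativeFlip lam q).2
      = lam • (p.1 - q.1) - (p.2 - q.2) := by
    simp only [dissipativeFlip]; module
  rw [this, inner_sub_left, inner_smul_left, ← real_inner_self_eq_norm_sq]
  rfl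

theorem isDissipative_iff_isMonotoneOp {lam : ℝ} {B : Set (E × E)} :
    IsDissipative lam B ↔ IsMonotoneOp (dissipativeFlip lam ⁻¹' B) := by
  constructor
  · intro h p hp q hq
    have h1 := h _ hp _ hq
    rw [← dissipativeFlip_dissipativeFlip lam p, ← dissipativeFlip_dissipativeFlip lam q,
      inner_dissipativeFlip]
    linarith
  · intro h p hp q hq
    have h1 := h (dissipativeFlip lam p)
      (by rwa [Set.mem_preimage, dissipativeFlip_dissipativeFlip])
      (dissipativeFlip lam q) (by rwa [Set.mem_preimage, dissipativeFlip_dissipativeFlip])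
    rw [inner_dissipativeFlip] at h1
    linarith

theorem isDissipative_closure {lam : ℝ} {B : Set (E × E)} (h : IsDissipative lam B) :
    IsDissipative lam (closure B) := by
  have hc : IsClosed {z : (E × E) × (E × E) |
      inner ℝ (z.1.2 - z.2.2) (z.1.1 - z.2.1) ≤ lam * ‖z.1.1 - z.2.1‖ ^ 2} :=
    isClosed_le (by fun_prop) (by fun_prop)
  have hsub : closure (B ×ˢ B) ⊆ {z : (E × E) × (E × E) |
      inner ℝ (z.1.2 - z.2.2) (z.1.1 - z.2.1) ≤ lam * ‖z.1.1 - z.2.1‖ ^ 2} :=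
    closure_minimal (fun z hz => h _ hz.1 _ hz.2) hc
  rw [closure_prod_eq] at hsub
  exact fun p hp q hq => hsub (Set.mk_mem_prod hp hq)

theorem IsMaximalDissipative.isClosed {lam : ℝ} {B : Set (E × E)}
    (h : IsMaximalDissipative lam B) : IsClosed B :=
  isClosed_of_closure_subset (h.2 (isDissipative_closure h.1) subset_closure)

/-- The extension is canonical, and therefore inherits every linear isometric symmetry. -/
theorem exists_isMaximalDissipative_extension [CompleteSpace E] {lam : ℝ} {B : Set (E × E)}
    (hne : B.Nonempty) (hB : IsDissipative lam B) :
    ∃ B' : Set (E × E), B ⊆ B' ∧ IsMaximalDissipative lam B' ∧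
      opDomain B' ⊆ closure (convexHull ℝ (opDomain B)) ∧
      ∀ g : E ≃ₗᵢ[ℝ] E, (∀ p, p ∈ B ↔ (g p.1, g p.2) ∈ B) → ∀ p ∈ B', (g p.1, g p.2) ∈ B' := by
  set A := dissipativeFlip lam ⁻¹' B with hA
  set C := closure (convexHull ℝ (opDomain B)) with hC
  have hcl : IsClosed C := isClosed_closure
  have hconv : Convex ℝ C := (convex_convexHull ℝ _).closure
  have hflip : ∀ B : Set (E × E), opDomain (dissipativeFlip lam ⁻¹' B) ⊆ opDomain B := by
    rintro B x ⟨v, hv⟩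
    exact ⟨_, hv⟩
  have hAC : opDomain A ⊆ C :=
    (hflip B).trans ((subset_convexHull ℝ _).trans subset_closure)
  have hmono : IsMonotoneOp A := isDissipative_iff_isMonotoneOp.1 hB
  have hAne : A.Nonempty := by
    obtain ⟨p, hp⟩ := hne
    exact ⟨dissipativeFlip lam p, by rwa [hA, Set.mem_preimage, dissipativeFlip_dissipativeFlip]⟩
  have hmap : ∀ (g : E ≃ₗᵢ[ℝ] E) (p : E × E), dissipativeFlip lam (g p.1, g p.2)
      = (g (dissipativeFlip lam p).1, g (dissipativeFlip lam p).2) := by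
    intro g p
    simp [dissipativeFlip]
  have hinv : ∀ D : Set (E × E), dissipativeFlip lam ⁻¹' (dissipativeFlip lam ⁻¹' D) = D := by
    intro D
    ext p
    simp [dissipativeFlip_dissipativeFlip]
  refine ⟨dissipativeFlip lam ⁻¹' fitzpatrickExtension A C, ?_, ⟨?_, ?_⟩, ?_, ?_⟩
  · rw [← hinv B]
    exact Set.preimage_mono (subset_fitzpatrickExtension hmono hAC)
  · rw [isDissipative_iff_isMonotoneOp, hinv]
    exact isMonotoneOp_fitzpatrickExtension
  · intro G hG hsub
    rw [← hinv G]
    refine Set.preimage_mono (eq_fitzpatrickExtension_of_subset hAne hmono hcl hconv hAC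
      (isDissipative_iff_isMonotoneOp.1 hG) ?_)
    have := Set.preimage_mono (f := dissipativeFlip lam) hsub
    rwa [hinv] at this
  · exact (hflip _).trans (opDomain_fitzpatrickExtension_subset hcl hconv hAC)
  · intro g hg p hp
    have hg' : ∀ p, (g.symm p.1, g.symm p.2) ∈ B ↔ p ∈ B := fun p => by
      rw [hg]; simp
    rw [Set.mem_preimage, hmap]
    refine map_mem_fitzpatrickExtension g (fun q => ?_) (fun x => ⟨fun hx => ?_, fun hx => ?_⟩) hp
    · rw [hA, Set.mem_preimage, Set.mem_preimage, hmap, ← hg]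
    · exact map_mem_closure_convexHull (D := opDomain B) g
        (fun x ⟨v, hv⟩ => ⟨g v, (hg (x, v)).1 hv⟩) hx
    · have := map_mem_closure_convexHull (D := opDomain B) g.symm
        (fun x ⟨v, hv⟩ => ⟨g.symm v, (hg' (x, v)).2 hv⟩) hx
      simpa using this

end Dissipative

/-! ### Nonatomic standard Borel probability spaces -/

section Nonatomic

open ProbabilityTheory unitInterval

/-- An essentially injective measure-preserving map between standard Borel spaces has an essential
inverse; the inverse is measurable by the Lusin–Souslin theorem. -/
theorem exists_essInverse {S T : Type*} [MeasurableSpace S] [StandardBorelSpace S]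
    [MeasurableSpace T] [StandardBorelSpace T] {μ : Measure S} {ν : Measure T}
    [IsProbabilityMeasure μ] {f : S → T} (hf : MeasurePreserving f μ ν) {S₀ : Set S}
    (hS₀ : MeasurableSet S₀) (hnull : μ S₀ᶜ = 0) (hinj : Set.InjOn f S₀) :
    ∃ h : T → S, MeasurePreserving h ν μ ∧
      (∃ T₀ : Set T, MeasurableSet T₀ ∧ ν T₀ᶜ = 0 ∧ Set.InjOn h T₀) ∧
      (∀ᵐ x ∂μ, h (f x) = x) ∧ ∀ᵐ y ∂ν, f (h y) = y := by
  have hSne : S₀.Nonempty := by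
    rw [Set.nonempty_iff_ne_empty]
    rintro rfl
    simp at hnull
  have : Nonempty S₀ := hSne.to_subtype
  have : StandardBorelSpace S₀ := hS₀.standardBorel
  have he : MeasurableEmbedding (fun x : S₀ => f x) :=
    (hf.measurable.comp measurable_subtype_coe).measurableEmbedding
      fun x y hxy => Subtype.ext (hinj x.2 y.2 hxy)
  set h : T → S := fun y => (he.invFun y : S) with hh
  have hmeas : Measurable h := measurable_subtype_coe.comp he.measurable_invFun
  have hleft : ∀ x ∈ S₀, h (f x) = x := fun x hx =>
    congrArg Subtype.val (he.leftInverse_invFun ⟨x, hx⟩)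
  have hae : ∀ᵐ x ∂μ, x ∈ S₀ := hnull
  have hT₀ : MeasurableSet (f '' S₀) := hS₀.image_of_measurable_injOn hf.measurable hinj
  have hT₀null : ν (f '' S₀)ᶜ = 0 := by
    rw [← hf.measure_preimage hT₀.compl.nullMeasurableSet]
    refine measure_mono_null (fun x hx hx' => hx ⟨x, hx', rfl⟩) hnull
  have hlae : ∀ᵐ x ∂μ, h (f x) = x := hae.mono hleft
  have hright : ∀ y ∈ f '' S₀, f (h y) = y := by
    rintro _ ⟨x, hx, rfl⟩
    rw [hleft x hx]
  refine ⟨h, ⟨hmeas, ?_⟩, ⟨f '' S₀, hT₀, hT₀null, ?_⟩, hlae, ?_⟩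
  · rw [← hf.map_eq, Measure.map_map hmeas hf.measurable]
    calc μ.map (h ∘ f) = μ.map id := Measure.map_congr hlae
      _ = μ := Measure.map_id
  · intro y hy z hz hyz
    rw [← hright y hy, ← hright z hz, hyz]
  · have : ∀ᵐ y ∂ν, y ∈ f '' S₀ := hT₀null
    exact this.mono hright

/-- The cumulative distribution function with values in the unit interval. -/
def unitCdf (μ : Measure ℝ) (x : ℝ) : I := ⟨cdf μ x, cdf_nonneg μ x, cdf_le_one μ x⟩

theorem monotone_unitCdf (μ : Measure ℝ) : Monotone (unitCdf μ) := fun _ _ h =>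
  monotone_cdf μ h

/-- The distribution function is injective off the preimage of the countable set of its values at
rational points, because an interval of constancy contains a rational point. -/
theorem injOn_unitCdf (μ : Measure ℝ) : Set.InjOn (unitCdf μ)
    (unitCdf μ ⁻¹' (Set.range fun r : ℚ => unitCdf μ r)ᶜ) := by
  have key : ∀ x y : ℝ, x < y → unitCdf μ x = unitCdf μ y →
      unitCdf μ x ∈ Set.range fun r : ℚ => unitCdf μ r := by
    intro x y hxy h
    obtain ⟨r, hr1, hr2⟩ := exists_rat_btwn hxy
    exact ⟨r, le_antisymm (h ▸ monotone_unitCdf μ hr2.le) (monotone_unitCdf μ hr1.le)⟩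
  intro x hx y hy h
  rcases lt_trichotomy x y with h1 | h1 | h1
  · exact absurd (key x y h1 h) hx
  · exact h1
  · exact absurd (key y x h1 h.symm) hy

theorem nullSingletonClass_map {Ω : Type*} [MeasurableSpace Ω] {P : Measure Ω}
    [NullSingletonClass P] {e : Ω → ℝ} (he : Measurable e) (hinj : Function.Injective e) :
    NullSingletonClass (P.map e) := by
  refine ⟨fun x => ?_⟩
  rw [Measure.map_apply he (measurableSet_singleton x)]
  exact (Set.subsingleton_singleton.preimage hinj).measure_zero P

variable {μ : Measure ℝ} [IsProbabilityMeasure μ] [NullSingletonClass μ]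

theorem continuous_cdf : Continuous (cdf μ) := by
  rw [continuous_iff_continuousAt]
  intro x
  rw [(monotone_cdf μ).continuousAt_iff_leftLim_eq_rightLim, StieltjesFunction.rightLim_eq]
  have h := (cdf μ).measure_singleton x
  rw [measure_cdf, measure_singleton] at h
  have h2 := ENNReal.ofReal_eq_zero.1 h.symm
  exact le_antisymm ((monotone_cdf μ).leftLim_le le_rfl) (by linarith)

theorem exists_cdf_eq {s : ℝ} (h0 : 0 < s) (h1 : s < 1) : ∃ x, cdf μ x = s := by
  obtain ⟨a, ha⟩ := ((tendsto_cdf_atBot μ).eventually_lt_const h0).exists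
  obtain ⟨b, hb⟩ := ((tendsto_cdf_atTop μ).eventually_const_lt h1).exists
  exact mem_range_of_exists_le_of_exists_ge continuous_cdf ⟨a, ha.le⟩ ⟨b, hb.le⟩

/-- The probability integral transform. -/
theorem measurePreserving_unitCdf : MeasurePreserving (unitCdf μ) μ volume := by
  have hm : Measurable (unitCdf μ) := (monotone_cdf μ).measurable.subtype_mk
  have : IsProbabilityMeasure (μ.map (unitCdf μ)) :=
    Measure.isProbabilityMeasure_map hm.aemeasurable
  refine ⟨hm, Measure.ext_of_Iic _ _ fun s => ?_⟩
  rw [Measure.map_apply hm measurableSet_Iic, unitInterval.volume_Iic]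
  refine le_antisymm ?_ ?_
  · rcases eq_or_lt_of_le s.2.2 with hs | hs
    · rw [hs, ENNReal.ofReal_one]
      exact prob_le_one
    refine le_of_forall_gt_imp_ge_of_dense fun c hc => ?_
    rcases le_or_gt 1 c with hc1 | hc1
    · exact prob_le_one.trans hc1
    have hctop : c ≠ ∞ := (hc1.trans ENNReal.one_lt_top).ne
    have hsc : (s : ℝ) < c.toReal := (ENNReal.ofReal_lt_iff_lt_toReal s.2.1 hctop).1 hc
    obtain ⟨x, hx⟩ := exists_cdf_eq (μ := μ) (lt_of_le_of_lt s.2.1 hsc)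
      (by simpa using (ENNReal.toReal_lt_toReal hctop ENNReal.one_ne_top).2 hc1)
    calc μ (unitCdf μ ⁻¹' Set.Iic s) ≤ μ (Set.Iic x) := by
          refine measure_mono fun z hz => ?_
          by_contra hzx
          have h1 : cdf μ z ≤ s := hz
          have h2 := monotone_cdf μ (not_le.1 hzx).le
          linarith
      _ = c := by rw [← ofReal_cdf, hx, ENNReal.ofReal_toReal hctop]
  · rcases eq_or_lt_of_le s.2.1 with hs | hs
    · simp [← hs]
    rcases eq_or_lt_of_le s.2.2 with hs1 | hs1
    · have : unitCdf μ ⁻¹' Set.Iic s = Set.univ := by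
        ext z
        have : s = 1 := Subtype.ext hs1
        simp [this, le_one']
      rw [this, hs1]
      simp
    obtain ⟨x, hx⟩ := exists_cdf_eq (μ := μ) hs hs1
    rw [← hx, ofReal_cdf]
    refine measure_mono fun z hz => ?_
    have : cdf μ z ≤ s := hx ▸ monotone_cdf μ hz
    exact this

/-- The uniform random variable built from a measurable injection into the line. -/
theorem unitCdf_comp {Ω : Type*} [MeasurableSpace Ω] {P : Measure Ω} [IsProbabilityMeasure P]
    [NullSingletonClass P] {e : Ω → ℝ} (he : Measurable e) (hinj : Function.Injective e) :
    MeasurePreserving (unitCdf (P.map e) ∘ e) P volume ∧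
      ∃ Ω₀ : Set Ω, MeasurableSet Ω₀ ∧ P Ω₀ᶜ = 0 ∧
        Set.InjOn (unitCdf (P.map e) ∘ e) Ω₀ := by
  have := nullSingletonClass_map (P := P) he hinj
  have := Measure.isProbabilityMeasure_map (μ := P) he.aemeasurable
  have hmp : MeasurePreserving (unitCdf (P.map e) ∘ e) P volume :=
    measurePreserving_unitCdf.comp (he.measurePreserving P)
  set D : Set I := Set.range fun r : ℚ => unitCdf (P.map e) r
  have hD : D.Countable := Set.countable_range _
  refine ⟨hmp, (unitCdf (P.map e) ∘ e) ⁻¹' Dᶜ, hmp.measurable hD.measurableSet.compl, ?_, ?_⟩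
  · rw [← Set.preimage_compl, compl_compl,
      hmp.measure_preimage hD.measurableSet.nullMeasurableSet]
    exact hD.measure_zero _
  · exact (injOn_unitCdf _).comp hinj.injOn fun ω hω => hω

variable {Ω : Type*} [MeasurableSpace Ω] [StandardBorelSpace Ω]
  {P : Measure Ω} [IsProbabilityMeasure P] [NullSingletonClass P]

variable (P) in
/-- Every Borel probability measure on a standard Borel space is the law of a random variable. -/
theorem exists_measurable_map_eq_of_nonatomic {Z : Type*} [MeasurableSpace Z]
    [StandardBorelSpace Z] (θ : Measure Z) [IsProbabilityMeasure θ] :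
    ∃ Y : Ω → Z, Measurable Y ∧ P.map Y = θ := by
  have : Nonempty Z := θ.nonempty_of_neZero
  obtain ⟨f, hf, hθ⟩ := θ.exists_measurable_map_eq
  have hU := (unitCdf_comp (P := P) (measurableEmbedding_embeddingReal Ω).measurable
    (measurableEmbedding_embeddingReal Ω).injective).1
  exact ⟨_, hf.comp hU.measurable, by
    rw [← Measure.map_map hf hU.measurable, hU.map_eq, hθ]⟩

/-- An injection of `Ω` into the line whose integer part is a prescribed discrete random
variable `k`; its distribution function at the integers depends only on the law of `k`. -/
def latticeEmbedding (k : Ω → ℕ) (ω : Ω) : ℝ := k ω + Real.sigmoid (embeddingReal Ω ω)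

theorem latticeEmbedding_le_natCast {k : Ω → ℕ} {ω : Ω} {n : ℕ} :
    latticeEmbedding k ω ≤ n ↔ k ω < n := by
  have h0 := Real.sigmoid_pos (embeddingReal Ω ω)
  have h1 := Real.sigmoid_lt_one (embeddingReal Ω ω)
  unfold latticeEmbedding
  constructor
  · intro h
    have : (k ω : ℝ) < n := by linarith
    exact_mod_cast this
  · intro h
    have : (k ω : ℝ) + 1 ≤ n := by exact_mod_cast h
    linarith

theorem measurable_latticeEmbedding {k : Ω → ℕ} (hk : Measurable k) :
    Measurable (latticeEmbedding k) := by
  have h1 : Measurable fun ω => (k ω : ℝ) := (measurable_of_countable _).comp hk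
  exact h1.add (continuous_sigmoid.measurable.comp
    (measurableEmbedding_embeddingReal Ω).measurable)

theorem latticeEmbedding_injective (k : Ω → ℕ) : Function.Injective (latticeEmbedding k) := by
  intro ω ω' h
  have hk : k ω = k ω' := by
    refine le_antisymm ?_ ?_
    · refine Nat.lt_succ_iff.1 (latticeEmbedding_le_natCast.1 ?_)
      rw [h]
      exact latticeEmbedding_le_natCast.2 (Nat.lt_succ_self _)
    · refine Nat.lt_succ_iff.1 (latticeEmbedding_le_natCast.1 ?_)
      rw [← h]
      exact latticeEmbedding_le_natCast.2 (Nat.lt_succ_self _)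
  simp only [latticeEmbedding, hk, add_right_inj] at h
  exact (measurableEmbedding_embeddingReal Ω).injective (Real.sigmoid_injective h)

/-- Discrete random variables with the same law differ by a measure-preserving isomorphism. -/
theorem exists_isMeasurePreservingIso_comp_eq {k k' : Ω → ℕ} (hk : Measurable k)
    (hk' : Measurable k') (hlaw : P.map k = P.map k') :
    ∃ g, IsMeasurePreservingIso P g ∧ ∀ᵐ ω ∂P, k (g ω) = k' ω := by
  set F := unitCdf (P.map (latticeEmbedding k)) with hF
  set F' := unitCdf (P.map (latticeEmbedding k')) with hF'
  set U := F ∘ latticeEmbedding k with hUdef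
  set U' := F' ∘ latticeEmbedding k' with hUdef'
  obtain ⟨hU, Ω₀, hΩ₀, hΩ₀', hinj⟩ := unitCdf_comp (P := P) (measurable_latticeEmbedding hk)
    (latticeEmbedding_injective k)
  obtain ⟨hU', Ω₁, hΩ₁, hΩ₁', hinj'⟩ := unitCdf_comp (P := P) (measurable_latticeEmbedding hk')
    (latticeEmbedding_injective k')
  obtain ⟨h, hmp, ⟨T₀, hT₀, hT₀', hinjh⟩, -, hUh⟩ := exists_essInverse hU hΩ₀ hΩ₀' hinj
  have hFF : ∀ n : ℕ, F n = F' n := by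
    intro n
    have e : ∀ j : Ω → ℕ, Measurable j → P.map (latticeEmbedding j) (Set.Iic (n : ℝ))
        = P.map j (Set.Iio n) := by
      intro j hj
      rw [Measure.map_apply (measurable_latticeEmbedding hj) measurableSet_Iic,
        Measure.map_apply hj measurableSet_Iio]
      congr 1
      ext ω
      exact latticeEmbedding_le_natCast
    have := Measure.isProbabilityMeasure_map (μ := P) (measurable_latticeEmbedding hk).aemeasurable
    have := Measure.isProbabilityMeasure_map (μ := P)
      (measurable_latticeEmbedding hk').aemeasurable
    refine Subtype.ext ?_
    simp only [hF, hF', unitCdf, ProbabilityTheory.cdf_eq_real, measureReal_def]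
    rw [e k hk, e k' hk', hlaw]
  -- Off its values at the integers, the distribution function determines the integer part.
  have hlt : ∀ (j j' : Ω → ℕ) (G G' : ℝ → I), Monotone G → Monotone G' →
      (∀ n : ℕ, G n = G' n) → ∀ ω ω', G (latticeEmbedding j ω) = G' (latticeEmbedding j' ω') →
      G (latticeEmbedding j ω) ∉ Set.range (fun n : ℕ => G n) → j' ω' ≤ j ω := by
    intro j j' G G' hG hG' hGG ω ω' heq hnot
    by_contra! hlt
    refine hnot ⟨j ω + 1, le_antisymm ?_ ?_⟩
    · have h1 : (((j ω + 1 : ℕ)) : ℝ) ≤ latticeEmbedding j' ω' := by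
        by_contra! h2
        have := latticeEmbedding_le_natCast.1 h2.le
        omega
      simp only
      rw [heq]
      have := hG' h1
      rw [← hGG] at this
      exact_mod_cast this
    · have := hG (latticeEmbedding_le_natCast.2 (Nat.lt_succ_self (j ω)))
      exact_mod_cast this
  have hg : MeasurePreserving (h ∘ U') P P := hmp.comp hU'
  refine ⟨h ∘ U', ⟨hg, Ω₁ ∩ U' ⁻¹' T₀, hΩ₁.inter (hU'.measurable hT₀), ?_, ?_⟩, ?_⟩
  · rw [Set.compl_inter, measure_union_null_iff]
    refine ⟨hΩ₁', ?_⟩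
    rw [← Set.preimage_compl, hU'.measure_preimage hT₀.compl.nullMeasurableSet, hT₀']
  · intro ω hω ω' hω' heq
    exact hinj' hω.1 hω'.1 (hinjh hω.2 hω'.2 heq)
  · have hN : (Set.range fun n : ℕ => F n).Countable := Set.countable_range _
    have h1 : ∀ᵐ s ∂(volume : Measure I), s ∉ Set.range fun n : ℕ => F n :=
      hN.ae_notMem _
    filter_upwards [hU'.quasiMeasurePreserving.ae h1, hU'.quasiMeasurePreserving.ae hUh]
      with ω hω1 hω2
    have heq : F (latticeEmbedding k ((h ∘ U') ω)) = F' (latticeEmbedding k' ω) := hω2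
    have hω1' : F' (latticeEmbedding k' ω) ∉ Set.range (fun n : ℕ => F n) := hω1
    refine le_antisymm ?_ ?_
    · refine hlt k' k F' F (monotone_unitCdf _) (monotone_unitCdf _) (fun n => (hFF n).symm) _ _
        heq.symm ?_
      simpa only [hFF] using hω1'
    · refine hlt k k' F F' (monotone_unitCdf _) (monotone_unitCdf _) hFF _ _ heq ?_
      rwa [heq]

/-- Random variables with the same law are uniformly close up to measure-preserving
isomorphisms. -/
theorem exists_isMeasurePreservingIso_dist_lt {Z : Type*} [PseudoMetricSpace Z]
    [MeasurableSpace Z] [OpensMeasurableSpace Z] [TopologicalSpace.SeparableSpace Z] {u u' : Ω → Z}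
    (hu : Measurable u) (hu' : Measurable u') (hlaw : P.map u = P.map u') {ε : ℝ} (hε : 0 < ε) :
    ∃ g, IsMeasurePreservingIso P g ∧ ∀ᵐ ω ∂P, dist (u (g ω)) (u' ω) < ε := by
  classical
  have : Nonempty Ω := P.nonempty_of_neZero
  have : Nonempty Z := ⟨u (Classical.arbitrary Ω)⟩
  set d := TopologicalSpace.denseSeq Z
  have hex : ∀ z : Z, ∃ n, dist z (d n) < ε / 2 := fun z =>
    (TopologicalSpace.denseRange_denseSeq Z).exists_dist_lt z (half_pos hε)
  set f : Z → ℕ := fun z => Nat.find (hex z) with hf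
  have hfm : Measurable f := measurable_find hex fun n => measurableSet_ball
  obtain ⟨g, hg, hgf⟩ := exists_isMeasurePreservingIso_comp_eq (P := P) (hfm.comp hu)
    (hfm.comp hu') (by rw [← Measure.map_map hfm hu, ← Measure.map_map hfm hu', hlaw])
  refine ⟨g, hg, hgf.mono fun ω hω => ?_⟩
  have h1 := Nat.find_spec (hex (u (g ω)))
  have h2 := Nat.find_spec (hex (u' ω))
  have h3 : Nat.find (hex (u (g ω))) = Nat.find (hex (u' ω)) := hω
  rw [h3] at h1
  calc _ ≤ _ := dist_triangle_right _ _ (d (Nat.find (hex (u' ω))))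
    _ < ε := by linarith

end Nonatomic

/-! ### Joint laws of square-integrable random variables -/

section JointLaw

variable {Ω : Type*} [MeasurableSpace Ω] {P : Measure Ω} {H : Type*} [NormedAddCommGroup H]

theorem lintegral_enorm_sq_lt_top (X : Lp H 2 P) : ∫⁻ ω, ‖X ω‖ₑ ^ 2 ∂P < ∞ := by
  have h := (Lp.memLp X).2
  rw [eLpNorm_lt_top_iff_lintegral_rpow_enorm_lt_top two_ne_zero ENNReal.ofNat_ne_top] at h
  simpa using h

theorem compMeasurePreserving_compMeasurePreserving {g h : Ω → Ω} (hg : MeasurePreserving g P P)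
    (hh : MeasurePreserving h P P) (hgh : ∀ᵐ ω ∂P, h (g ω) = ω) (X : Lp H 2 P) :
    Lp.compMeasurePreserving g hg (Lp.compMeasurePreserving h hh X) = X := by
  refine Lp.ext ?_
  filter_upwards [Lp.coeFn_compMeasurePreserving (Lp.compMeasurePreserving h hh X) hg,
    hg.quasiMeasurePreserving.ae (Lp.coeFn_compMeasurePreserving X hh), hgh] with ω h1 h2 h3
  rw [h1, Function.comp_apply, h2, Function.comp_apply, h3]

variable [MeasurableSpace H]

theorem isLawInvariant_lagrangianRep (F : Set (Measure (H × H))) :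
    IsLawInvariant (lagrangianRep P F) := by
  intro p hp q h
  rwa [lagrangianRep, Set.mem_ofPred_eq, ← h]

/-- A law-invariant operator is the Lagrangian representation of its set of laws. -/
theorem IsLawInvariant.lagrangianRep_image {B : Set (Lp H 2 P × Lp H 2 P)}
    (hB : IsLawInvariant B) : lagrangianRep P (jointLaw '' B) = B := by
  refine Set.Subset.antisymm ?_ fun p hp => ⟨p, hp, rfl⟩
  rintro q ⟨p, hp, hpq⟩
  exact hB p hp q hpq

variable [BorelSpace H]

theorem measurable_coeFn_Lp (X : Lp H 2 P) : Measurable X := (Lp.stronglyMeasurable X).measurable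

theorem measurable_jointLaw_fun (p : Lp H 2 P × Lp H 2 P) :
    Measurable fun ω => (p.1 ω, p.2 ω) :=
  (measurable_coeFn_Lp p.1).prodMk (measurable_coeFn_Lp p.2)

theorem jointLaw_compMeasurePreserving {g : Ω → Ω} (hg : MeasurePreserving g P P)
    (p : Lp H 2 P × Lp H 2 P) :
    jointLaw (Lp.compMeasurePreserving g hg p.1, Lp.compMeasurePreserving g hg p.2)
      = jointLaw p := by
  have hae : (fun ω => (Lp.compMeasurePreserving g hg p.1 ω, Lp.compMeasurePreserving g hg p.2 ω))
      =ᵐ[P] (fun ω => (p.1 ω, p.2 ω)) ∘ g := by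
    filter_upwards [Lp.coeFn_compMeasurePreserving p.1 hg, Lp.coeFn_compMeasurePreserving p.2 hg]
      with ω h1 h2
    rw [h1, h2]
    rfl
  rw [jointLaw, Measure.map_congr hae, ← Measure.map_map (measurable_jointLaw_fun p) hg.measurable,
    hg.map_eq]
  rfl

theorem IsLawInvariant.isIsoInvariant {B : Set (Lp H 2 P × Lp H 2 P)} (hB : IsLawInvariant B) :
    IsIsoInvariant B := fun _ hg p hp =>
  hB p hp _ (jointLaw_compMeasurePreserving hg.measurePreserving p).symm

theorem map_fst_jointLaw (p : Lp H 2 P × Lp H 2 P) : (jointLaw p).map Prod.fst = P.map p.1 := by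
  rw [jointLaw, Measure.map_map measurable_fst (measurable_jointLaw_fun p)]
  rfl

variable [TopologicalSpace.SeparableSpace H]

theorem jointLaw_mem_probTwo [IsProbabilityMeasure P] (p : Lp H 2 P × Lp H 2 P) :
    jointLaw p ∈ probTwo (H × H) := by
  have := UniformSpace.secondCountable_of_separable H
  refine ⟨Measure.isProbabilityMeasure_map (measurable_jointLaw_fun p).aemeasurable, ?_⟩
  rw [jointLaw, lintegral_map (by fun_prop) (measurable_jointLaw_fun p)]
  have hle : ∀ ω, ‖(p.1 ω, p.2 ω)‖ₑ ^ 2 ≤ ‖p.1 ω‖ₑ ^ 2 + ‖p.2 ω‖ₑ ^ 2 := by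
    intro ω
    rcases le_total ‖p.1 ω‖ ‖p.2 ω‖ with h | h
    · have : ‖(p.1 ω, p.2 ω)‖ₑ = ‖p.2 ω‖ₑ := enorm_eq_iff_norm_eq.2 (max_eq_right h)
      rw [this]
      exact le_add_self
    · have : ‖(p.1 ω, p.2 ω)‖ₑ = ‖p.1 ω‖ₑ := enorm_eq_iff_norm_eq.2 (max_eq_left h)
      rw [this]
      exact le_self_add
  refine (lintegral_mono hle).trans_lt ?_
  rw [lintegral_add_left ((measurable_coeFn_Lp p.1).enorm.pow_const 2)]
  exact ENNReal.add_lt_top.2 ⟨lintegral_enorm_sq_lt_top _, lintegral_enorm_sq_lt_top _⟩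

theorem memLp_fst_snd_of_map_mem_probTwo {Y : Ω → H × H} (hY : Measurable Y)
    (h : P.map Y ∈ probTwo (H × H)) :
    MemLp (fun ω => (Y ω).1) 2 P ∧ MemLp (fun ω => (Y ω).2) 2 P := by
  have := UniformSpace.secondCountable_of_separable H
  have h2 := h.2
  rw [lintegral_map (by fun_prop) hY] at h2
  have key : ∀ f : Ω → H, Measurable f → (∀ ω, ‖f ω‖ₑ ≤ ‖Y ω‖ₑ) → MemLp f 2 P := by
    intro f hf hle
    refine ⟨hf.aestronglyMeasurable, ?_⟩
    rw [eLpNorm_lt_top_iff_lintegral_rpow_enorm_lt_top two_ne_zero ENNReal.ofNat_ne_top]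
    refine lt_of_le_of_lt (lintegral_mono fun ω => ?_) h2
    simpa using pow_le_pow_left' (hle ω) 2
  exact ⟨key _ hY.fst fun ω => enorm_le_iff_norm_le.2 (norm_fst_le _),
    key _ hY.snd fun ω => enorm_le_iff_norm_le.2 (norm_snd_le _)⟩

/-- Couplings of elements of `P₂(H × H)` are laws of pairs of pairs of square-integrable random
variables. -/
theorem exists_pair_of_mem_couplings [StandardBorelSpace Ω] [IsProbabilityMeasure P]
    [NullSingletonClass P] [CompleteSpace H]
    {Φ₀ Φ₁ : Measure (H × H)} (h₀ : Φ₀ ∈ probTwo (H × H)) (h₁ : Φ₁ ∈ probTwo (H × H))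
    {θ : Measure ((H × H) × (H × H))} (hθ : θ ∈ couplings Φ₀ Φ₁) :
    ∃ p q : Lp H 2 P × Lp H 2 P, jointLaw p = Φ₀ ∧ jointLaw q = Φ₁ ∧
      θ = P.map fun ω => ((p.1 ω, p.2 ω), (q.1 ω, q.2 ω)) := by
  have := UniformSpace.secondCountable_of_separable H
  have : PolishSpace H := {}
  obtain ⟨hθP, hθ₀, hθ₁⟩ := hθ
  obtain ⟨Y, hY, hYθ⟩ := exists_measurable_map_eq_of_nonatomic P θ
  have e₀ : P.map (fun ω => (Y ω).1) = Φ₀ := by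
    rw [← hθ₀, ← hYθ, Measure.map_map measurable_fst hY]
    rfl
  have e₁ : P.map (fun ω => (Y ω).2) = Φ₁ := by
    rw [← hθ₁, ← hYθ, Measure.map_map measurable_snd hY]
    rfl
  obtain ⟨m1, m2⟩ := memLp_fst_snd_of_map_mem_probTwo hY.fst (by rwa [e₀])
  obtain ⟨m3, m4⟩ := memLp_fst_snd_of_map_mem_probTwo hY.snd (by rwa [e₁])
  refine ⟨(m1.toLp _, m2.toLp _), (m3.toLp _, m4.toLp _), ?_, ?_, ?_⟩
  · rw [← e₀]
    refine Measure.map_congr ?_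
    filter_upwards [m1.coeFn_toLp, m2.coeFn_toLp] with ω w1 w2
    simp only [w1, w2]
  · rw [← e₁]
    refine Measure.map_congr ?_
    filter_upwards [m3.coeFn_toLp, m4.coeFn_toLp] with ω w1 w2
    simp only [w1, w2]
  · rw [← hYθ]
    refine Measure.map_congr ?_
    filter_upwards [m1.coeFn_toLp, m2.coeFn_toLp, m3.coeFn_toLp, m4.coeFn_toLp]
      with ω w1 w2 w3 w4
    simp only [w1, w2, w3, w4]

theorem exists_jointLaw_eq [StandardBorelSpace Ω] [IsProbabilityMeasure P]
    [NullSingletonClass P] [CompleteSpace H] {Φ : Measure (H × H)} (h : Φ ∈ probTwo (H × H)) :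
    ∃ p : Lp H 2 P × Lp H 2 P, jointLaw p = Φ := by
  have := h.1
  obtain ⟨p, -, hp, -⟩ := exists_pair_of_mem_couplings (P := P) h h
    (θ := Φ.prod Φ) ⟨inferInstance, by simp, by simp⟩
  exact ⟨p, hp⟩

theorem map_prod_mem_couplings [IsProbabilityMeasure P] {S T : Type*} [MeasurableSpace S]
    [MeasurableSpace T] {f : Ω → S} {g : Ω → T} (hf : Measurable f) (hg : Measurable g) :
    P.map (fun ω => (f ω, g ω)) ∈ couplings (P.map f) (P.map g) := by
  refine ⟨Measure.isProbabilityMeasure_map (hf.prodMk hg).aemeasurable, ?_, ?_⟩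
  · rw [Measure.map_map measurable_fst (hf.prodMk hg)]; rfl
  · rw [Measure.map_map measurable_snd (hf.prodMk hg)]; rfl

theorem image_jointLaw_subset_probTwo [IsProbabilityMeasure P]
    (B : Set (Lp H 2 P × Lp H 2 P)) :
    jointLaw '' B ⊆ probTwo (H × H) := by
  rintro _ ⟨p, -, rfl⟩
  exact jointLaw_mem_probTwo p

theorem image_jointLaw_lagrangianRep [StandardBorelSpace Ω] [IsProbabilityMeasure P]
    [NullSingletonClass P] [CompleteSpace H] {F : Set (Measure (H × H))}
    (hF : F ⊆ probTwo (H × H)) :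
    jointLaw '' (lagrangianRep P F) = F := by
  refine Set.Subset.antisymm ?_ fun Φ hΦ => ?_
  · rintro _ ⟨p, hp, rfl⟩
    exact hp
  · obtain ⟨p, rfl⟩ := exists_jointLaw_eq (P := P) (hF hΦ)
    exact ⟨p, hΦ, rfl⟩

theorem wassersteinTwo_map_le [IsProbabilityMeasure P] (X Y : Lp H 2 P) :
    wassersteinTwo (P.map X) (P.map Y) ≤ ‖X - Y‖ₑ := by
  have := UniformSpace.secondCountable_of_separable H
  have h1 : (⨅ γ ∈ couplings (P.map X) (P.map Y), ∫⁻ z, ‖z.1 - z.2‖ₑ ^ 2 ∂γ)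
      ≤ ∫⁻ ω, ‖(X - Y : Lp H 2 P) ω‖ₑ ^ 2 ∂P := by
    refine (iInf₂_le _ (map_prod_mem_couplings (P := P) (measurable_coeFn_Lp X)
      (measurable_coeFn_Lp Y))).trans_eq ?_
    rw [lintegral_map (by fun_prop) ((measurable_coeFn_Lp X).prodMk (measurable_coeFn_Lp Y))]
    refine lintegral_congr_ae ?_
    filter_upwards [Lp.coeFn_sub X Y] with ω h
    rw [h]
    rfl
  refine (ENNReal.rpow_le_rpow h1 (by norm_num)).trans_eq ?_
  rw [Lp.enorm_def, eLpNorm_eq_lintegral_rpow_enorm_toReal two_ne_zero ENNReal.ofNat_ne_top]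
  simp

theorem isClosed_setOf_map_mem [IsProbabilityMeasure P] {K : Set (Measure H)}
    (hK : IsWassersteinClosed K) :
    IsClosed {X : Lp H 2 P | P.map X ∈ K} := by
  have := UniformSpace.secondCountable_of_separable H
  refine IsSeqClosed.isClosed fun Xs X hXs hlim => ?_
  refine hK _ _ hXs ⟨Measure.isProbabilityMeasure_map (measurable_coeFn_Lp X).aemeasurable, ?_⟩ ?_
  · rw [lintegral_map (by fun_prop) (measurable_coeFn_Lp X)]
    exact lintegral_enorm_sq_lt_top X
  · have h1 : Tendsto (fun n => ‖Xs n - X‖ₑ) atTop (𝓝 0) := by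
      have := (hlim.sub_const X).enorm
      simpa using this
    exact tendsto_of_tendsto_of_tendsto_of_le_of_le tendsto_const_nhds h1
      (fun _ => zero_le) fun n => wassersteinTwo_map_le _ _

/-- A closed operator invariant by measure-preserving isomorphisms is law invariant, since a pair
with the same law is a limit of rearrangements. -/
theorem IsIsoInvariant.isLawInvariant [StandardBorelSpace Ω] [IsProbabilityMeasure P]
    [NullSingletonClass P] {B : Set (Lp H 2 P × Lp H 2 P)} (hB : IsIsoInvariant B)
    (hcl : IsClosed B) : IsLawInvariant B := by
  have := UniformSpace.secondCountable_of_separable H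
  intro p hp q hpq
  rw [← hcl.closure_eq, Metric.mem_closure_iff]
  intro ε hε
  obtain ⟨g, hg, hdist⟩ := exists_isMeasurePreservingIso_dist_lt (measurable_jointLaw_fun p)
    (measurable_jointLaw_fun q) hpq (half_pos hε)
  refine ⟨_, hB g hg p hp, ?_⟩
  have key : ∀ X Y : Lp H 2 P, (∀ᵐ ω ∂P, dist (X (g ω)) (Y ω) < ε / 2) →
      dist Y (Lp.compMeasurePreserving g hg.measurePreserving X) ≤ ε / 2 := by
    intro X Y h
    rw [dist_comm, dist_eq_norm]
    have := Lp.norm_le_of_ae_bound (p := 2)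
      (f := Lp.compMeasurePreserving g hg.measurePreserving X - Y) (half_pos hε).le (by
        filter_upwards [h, Lp.coeFn_compMeasurePreserving X hg.measurePreserving,
          Lp.coeFn_sub (Lp.compMeasurePreserving g hg.measurePreserving X) Y] with ω h1 h2 h3
        rw [h3, Pi.sub_apply, h2, ← dist_eq_norm]
        exact h1.le)
    simpa [measureUnivNNReal] using this
  rw [Prod.dist_eq]
  have h1 := key p.1 q.1 (hdist.mono fun ω hω => lt_of_le_of_lt (le_max_left _ _) hω)
  have h2 := key p.2 q.2 (hdist.mono fun ω hω => lt_of_le_of_lt (le_max_right _ _) hω)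
  exact lt_of_le_of_lt (max_le h1 h2) (half_lt_self hε)

end JointLaw

/-! ### Dissipativity of Lagrangian representations and maximal invariant extensions -/

section Hilbert

variable {Ω : Type*} [MeasurableSpace Ω]
  {P : Measure Ω}
  {H : Type*} [NormedAddCommGroup H] [InnerProductSpace ℝ H]

/-- The unitary operator `X ↦ X ∘ g` on `L²` induced by an essentially invertible
measure-preserving map. -/
def koopman {g h : Ω → Ω} (hg : MeasurePreserving g P P) (hh : MeasurePreserving h P P)
    (hgh : ∀ᵐ ω ∂P, h (g ω) = ω) (hhg : ∀ᵐ ω ∂P, g (h ω) = ω) : Lp H 2 P ≃ₗᵢ[ℝ] Lp H 2 P where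
  toFun := Lp.compMeasurePreserving g hg
  invFun := Lp.compMeasurePreserving h hh
  map_add' := map_add _
  map_smul' c X := (Lp.compMeasurePreservingₗ ℝ g hg).map_smul c X
  left_inv := compMeasurePreserving_compMeasurePreserving hh hg hhg
  right_inv := compMeasurePreserving_compMeasurePreserving hg hh hgh
  norm_map' X := Lp.norm_compMeasurePreserving X hg

variable [TopologicalSpace.SeparableSpace H] [MeasurableSpace H] [BorelSpace H]

theorem integral_inner_map_pair (p q : Lp H 2 P × Lp H 2 P) :
    ∫ z, inner ℝ (z.2.2 - z.1.2) (z.2.1 - z.1.1)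
        ∂(P.map fun ω => ((p.1 ω, p.2 ω), (q.1 ω, q.2 ω)))
      = inner ℝ (q.2 - p.2) (q.1 - p.1) := by
  have := UniformSpace.secondCountable_of_separable H
  rw [integral_map ((measurable_jointLaw_fun p).prodMk (measurable_jointLaw_fun q)).aemeasurable
    (Continuous.aestronglyMeasurable (by fun_prop)), L2.inner_def]
  refine integral_congr_ae ?_
  filter_upwards [Lp.coeFn_sub q.2 p.2, Lp.coeFn_sub q.1 p.1] with ω h1 h2
  rw [h1, h2]
  rfl

theorem integral_norm_sq_map_pair (p q : Lp H 2 P × Lp H 2 P) :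
    ∫ z, ‖z.2.1 - z.1.1‖ ^ 2 ∂(P.map fun ω => ((p.1 ω, p.2 ω), (q.1 ω, q.2 ω)))
      = ‖q.1 - p.1‖ ^ 2 := by
  have h := integral_inner_map_pair (p.1, p.1) (q.1, q.1)
  have := UniformSpace.secondCountable_of_separable H
  rw [real_inner_self_eq_norm_sq] at h
  rw [← h, integral_map ((measurable_jointLaw_fun _).prodMk
      (measurable_jointLaw_fun _)).aemeasurable (Continuous.aestronglyMeasurable (by fun_prop)),
    integral_map ((measurable_jointLaw_fun _).prodMk
      (measurable_jointLaw_fun _)).aemeasurable (Continuous.aestronglyMeasurable (by fun_prop))]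
  simp only [real_inner_self_eq_norm_sq]

variable [IsProbabilityMeasure P] {lam : ℝ}

theorem isTotallyDissipative_iff [StandardBorelSpace Ω] [NullSingletonClass P] [CompleteSpace H]
    {F : Set (Measure (H × H))} (hF : F ⊆ probTwo (H × H)) :
    IsTotallyDissipative lam F ↔ IsDissipative lam (lagrangianRep P F) := by
  constructor
  · intro h p hp q hq
    have := h _ hq _ hp _
      (map_prod_mem_couplings (measurable_jointLaw_fun q) (measurable_jointLaw_fun p))
    rwa [integral_inner_map_pair, integral_norm_sq_map_pair] at this
  · intro h Φ₀ h₀ Φ₁ h₁ θ hθ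
    obtain ⟨p, q, hp, hq, rfl⟩ := exists_pair_of_mem_couplings (P := P) (hF h₀) (hF h₁) hθ
    rw [integral_inner_map_pair, integral_norm_sq_map_pair]
    exact h q (by rwa [lagrangianRep, Set.mem_ofPred_eq, hq]) p
      (by rwa [lagrangianRep, Set.mem_ofPred_eq, hp])

variable [StandardBorelSpace Ω] [NullSingletonClass P] [CompleteSpace H]

/-- The extension is canonical, hence has all the symmetries `X ↦ X ∘ g`; essential inverses are
needed because a symmetry has to preserve the complement of `B` as well. -/
theorem exists_isMaximalDissipative_isLawInvariant_of_nonempty {B : Set (Lp H 2 P × Lp H 2 P)}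
    (hB : IsDissipative lam B) (hinv : IsIsoInvariant B) (hne : B.Nonempty) :
    ∃ B' : Set (Lp H 2 P × Lp H 2 P), B ⊆ B' ∧ IsMaximalDissipative lam B' ∧ IsLawInvariant B' ∧
      opDomain B' ⊆ closure (convexHull ℝ (opDomain B)) := by
  obtain ⟨B', hsub, hmax, hdom, hsymm⟩ := exists_isMaximalDissipative_extension hne hB
  refine ⟨B', hsub, hmax, ?_, hdom⟩
  refine IsIsoInvariant.isLawInvariant (fun g hg p hp => ?_) hmax.isClosed
  obtain ⟨Ω₀, hΩ₀, hnull, hinj⟩ := hg.essInjective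
  obtain ⟨h, hh, hhinj, hgh, hhg⟩ := exists_essInverse hg.measurePreserving hΩ₀ hnull hinj
  refine hsymm (koopman hg.measurePreserving hh hgh hhg)
    (fun p => ⟨fun hp => hinv g hg p hp, fun hp => ?_⟩) p hp
  have h1 := hinv h ⟨hh, hhinj⟩ _ hp
  have e : ∀ X : Lp H 2 P, Lp.compMeasurePreserving h hh
      (koopman hg.measurePreserving hh hgh hhg X) = X :=
    compMeasurePreserving_compMeasurePreserving hh hg.measurePreserving hhg
  simpa only [e] using h1

theorem exists_isMaximalDissipative_isLawInvariant {B : Set (Lp H 2 P × Lp H 2 P)}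
    (hB : IsDissipative lam B) (hinv : IsIsoInvariant B) :
    ∃ B' : Set (Lp H 2 P × Lp H 2 P), B ⊆ B' ∧ IsMaximalDissipative lam B' ∧ IsLawInvariant B' ∧
      (B.Nonempty → opDomain B' ⊆ closure (convexHull ℝ (opDomain B))) := by
  rcases B.eq_empty_or_nonempty with rfl | hne
  · -- The empty operator is first extended to `{(0, 0)}`.
    obtain ⟨B', -, hmax, hlaw, -⟩ := exists_isMaximalDissipative_isLawInvariant_of_nonempty
      (lam := lam) (B := {(0 : Lp H 2 P × Lp H 2 P)})
      (by rintro _ rfl _ rfl; simp)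
      (by rintro g hg _ rfl; simp) (Set.singleton_nonempty _)
    exact ⟨B', Set.empty_subset _, hmax, hlaw, fun h => absurd h Set.not_nonempty_empty⟩
  · obtain ⟨B', h1, h2, h3, h4⟩ :=
      exists_isMaximalDissipative_isLawInvariant_of_nonempty hB hinv hne
    exact ⟨B', h1, h2, h3, fun _ => h4⟩

/-- If `F` is maximal, so is its representation: a maximal extension of the latter may be taken law
invariant, and its laws then form a totally dissipative extension of `F`. -/
theorem isMaximalDissipative_lagrangianRep_iff {F : Set (Measure (H × H))} (hF : IsMPVF F) :
    IsMaximalDissipative lam (lagrangianRep P F) ↔ IsMaximalTotallyDissipative lam F := by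
  constructor
  · intro h
    refine ⟨⟨hF, (isTotallyDissipative_iff hF.2).2 h.1⟩, fun G hG hFG => ?_⟩
    have h1 := h.2 ((isTotallyDissipative_iff (P := P) hG.1.2).1 hG.2) fun p hp => hFG hp
    have h2 := Set.image_mono (f := jointLaw) h1
    rwa [image_jointLaw_lagrangianRep hG.1.2, image_jointLaw_lagrangianRep hF.2] at h2
  · intro h
    obtain ⟨B', hsub, hmax, hlaw, -⟩ := exists_isMaximalDissipative_isLawInvariant
      ((isTotallyDissipative_iff (P := P) hF.2).1 h.1.2)
      (isLawInvariant_lagrangianRep F).isIsoInvariant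
    have hFG : F ⊆ jointLaw '' B' := by
      rw [← image_jointLaw_lagrangianRep (P := P) hF.2]
      exact Set.image_mono hsub
    have hB' := image_jointLaw_subset_probTwo B'
    have h1 := h.2 ⟨⟨hF.1.mono hFG, hB'⟩, (isTotallyDissipative_iff (P := P) hB').2
      (by rw [hlaw.lagrangianRep_image]; exact hmax.1)⟩ hFG
    have : lagrangianRep P F = B' :=
      hsub.antisymm fun p hp => h1 ⟨p, hp, rfl⟩
    rwa [this]

end Hilbert

/-! ### Random variables with law in a totally convex set -/

section TotallyConvex

variable {Ω : Type*} [MeasurableSpace Ω]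
  {P : Measure Ω} [IsProbabilityMeasure P]
  {H : Type*} [NormedAddCommGroup H] [InnerProductSpace ℝ H]
  [TopologicalSpace.SeparableSpace H] [MeasurableSpace H] [BorelSpace H]
  {K : Set (Measure H)}

theorem convex_setOf_map_mem (hK : IsTotallyConvex K) :
    Convex ℝ {X : Lp H 2 P | P.map X ∈ K} := by
  have := UniformSpace.secondCountable_of_separable H
  intro X hX Y hY a b ha hb hab
  have h := hK _ hX _ hY _ (map_prod_mem_couplings (P := P) (measurable_coeFn_Lp X)
    (measurable_coeFn_Lp Y)) b ⟨hb, by linarith⟩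
  rw [Measure.map_map (by fun_prop) ((measurable_coeFn_Lp X).prodMk (measurable_coeFn_Lp Y))] at h
  have e : (a • X + b • Y : Lp H 2 P) =ᵐ[P]
      (fun z : H × H => (1 - b) • z.1 + b • z.2) ∘ fun ω => (X ω, Y ω) := by
    filter_upwards [Lp.coeFn_add (a • X) (b • Y), Lp.coeFn_smul a X, Lp.coeFn_smul b Y]
      with ω h1 h2 h3
    have : 1 - b = a := by linarith
    simp only [h1, Pi.add_apply, h2, h3, Pi.smul_apply, Function.comp_apply, this]
  rw [Set.mem_ofPred_eq, Measure.map_congr e]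
  exact h

theorem exists_isMaximalTotallyDissipative_extension [StandardBorelSpace Ω] [NullSingletonClass P]
    [CompleteSpace H] {lam : ℝ} {F : Set (Measure (H × H))} (hF : IsMPVF F)
    (hdiss : IsTotallyDissipative lam F) (hKcl : IsWassersteinClosed K) (hKconv : IsTotallyConvex K)
    (hFK : mpvfDomain F ⊆ K) :
    ∃ F' : Set (Measure (H × H)), F ⊆ F' ∧ IsMaximalTotallyDissipative lam F' ∧
      mpvfDomain F' ⊆ K := by
  obtain ⟨B', hsub, hmax, hlaw, hdom⟩ := exists_isMaximalDissipative_isLawInvariant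
    ((isTotallyDissipative_iff (P := P) hF.2).1 hdiss)
    (isLawInvariant_lagrangianRep F).isIsoInvariant
  have hne : (lagrangianRep P F).Nonempty := by
    rw [← Set.image_nonempty (f := jointLaw), image_jointLaw_lagrangianRep hF.2]
    exact hF.1
  have hFG : F ⊆ jointLaw '' B' := by
    rw [← image_jointLaw_lagrangianRep (P := P) hF.2]
    exact Set.image_mono hsub
  refine ⟨jointLaw '' B', hFG, ?_, ?_⟩
  · rw [← isMaximalDissipative_lagrangianRep_iff (P := P)
      ⟨hF.1.mono hFG, image_jointLaw_subset_probTwo B'⟩, hlaw.lagrangianRep_image]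
    exact hmax
  · rintro _ ⟨_, ⟨p, hp, rfl⟩, rfl⟩
    rw [map_fst_jointLaw]
    have h1 : closure (convexHull ℝ (opDomain (lagrangianRep P F)))
        ⊆ {X : Lp H 2 P | P.map X ∈ K} := by
      refine closure_minimal (convexHull_min ?_ (convex_setOf_map_mem hKconv))
        (isClosed_setOf_map_mem hKcl)
      rintro X ⟨V, hV⟩
      exact hFK ⟨_, hV, map_fst_jointLaw _⟩
    exact h1 (hdom hne ⟨p.2, hp⟩)

end TotallyConvex

end

theorem mainTheorem1
    {Ω : Type*} [MeasurableSpace Ω] [StandardBorelSpace Ω]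
    (P : Measure Ω) [IsProbabilityMeasure P] [NullSingletonClass P]
    {H : Type*} [NormedAddCommGroup H] [InnerProductSpace ℝ H] [CompleteSpace H]
    [TopologicalSpace.SeparableSpace H] [MeasurableSpace H] [BorelSpace H]
    (lam : ℝ) :
    -- total dissipativity of `F` and dissipativity of its Lagrangian representation
    (∀ F : Set (Measure (H × H)), F ⊆ probTwo (H × H) →
      IsLawInvariant (lagrangianRep P F) ∧
      (IsTotallyDissipative lam F ↔ IsDissipative lam (lagrangianRep P F))) ∧
    -- maximal invariant extensions of invariant dissipative operators
    (∀ B : Set (Lp H 2 P × Lp H 2 P), IsDissipative lam B → IsIsoInvariant B →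
      ∃ B' : Set (Lp H 2 P × Lp H 2 P), B ⊆ B' ∧ IsMaximalDissipative lam B' ∧
        IsIsoInvariant B' ∧ IsLawInvariant B' ∧
        (B.Nonempty → opDomain B' ⊆ closure (convexHull ℝ (opDomain B)))) ∧
    -- maximality of `F` and of its Lagrangian representation
    (∀ F : Set (Measure (H × H)), IsMPVF F →
      (IsMaximalDissipative lam (lagrangianRep P F) ↔ IsMaximalTotallyDissipative lam F)) ∧
    -- maximal totally dissipative extensions with controlled domain
    (∀ (F : Set (Measure (H × H))) (K : Set (Measure H)), IsMPVF F →
      IsTotallyDissipative lam F → K ⊆ probTwo H → IsWassersteinClosed K → IsTotallyConvex K →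
      mpvfDomain F ⊆ K →
      ∃ F' : Set (Measure (H × H)), F ⊆ F' ∧ IsMaximalTotallyDissipative lam F' ∧
        mpvfDomain F' ⊆ K) := by
  refine ⟨fun F hF => ⟨isLawInvariant_lagrangianRep F, isTotallyDissipative_iff hF⟩,
    fun B hB hinv => ?_, fun F hF => isMaximalDissipative_lagrangianRep_iff hF,
    fun F K hF hdiss _ hKcl hKconv hFK =>
      exists_isMaximalTotallyDissipative_extension (P := P) hF hdiss hKcl hKconv hFK⟩
  obtain ⟨B', hsub, hmax, hlaw, hdom⟩ := exists_isMaximalDissipative_isLawInvariant hB hinv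
  exact ⟨B', hsub, hmax, hlaw.isIsoInvariant, hlaw, hdom⟩
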